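/- Let $(E,\|\cdot\|)$ be a finite-dimensional real normed space with dual $E^*$ and dual norm $\|\cdot\|_*$, let $Q\subseteq E$ be convex and compact, let $m\ge 1$, let $M>0$, and let $f, g^{(1)},\dots,g^{(m)}:Q\to\mathbb{R}$ be convex and $M$-Lipschitz, such that Slater's condition holds: some $x\in Q$ has $g^{(l)}(x)<0$ for all $l$. Consider the problem $\min_{x\in Q} f(x)$ subject to $g^{(l)}(x)\le 0$ for all $l$, with dual function $\phi(\lambda)=\min_{x\in Q}\{f(x)+\sum_{l}\lambda_l g^{(l)}(x)\}$, $\lambda\in\mathbb{R}^m_+$, and duality gap $\Delta(x,\lambda)=f(x)-\phi(\lambda)$. Let $\nabla f(x)$, $\nabla g^{(l)}(x)$ be subgradients at $x \in Q$, and let $\nabla f(x,\xi)$, $\nabla g^{(l)}(x,\xi_{(l)})$ be stochastic subgradients with $\mathbb{E}\nabla f(x,\xi)=\nabla f(x)$, $\mathbb{E}\nabla g^{(l)}(x,\xi_{(l)})=\nabla g^{(l)}(x)$ and $\|\nabla f(x,\xi)\|_*\le M$, $\|\nabla g^{(l)}(x,\xi_{(l)})\|_*\le M$ almost surely, for every $x\in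 Q$. Let $\delta\ge0$, and let $g^{(l)}_\delta:Q\to\mathbb{R}$ satisfy $|g^{(l)}_\delta(x)-g^{(l)}(x)|\le\delta$ for all $x\in Q$. Let $d:Q\to\mathbb{R}$ be continuous and $1$-strongly convex with respect to $\|\cdot\|$, with a selection $\nabla d(x)$ of its subgradients that is continuous on the set of points where they exist; put $V(x,y)=d(y)-d(x)-\langle\nabla d(x),y-x\rangle$ and $\operatorname{Mirr}(x,v)=\operatorname{argmin}_{y\in Q}\{\langle v,y\rangle+V(x,y)\}$. Let $\varepsilon>0$ and $\eta=\varepsilon/M^2$. Stochastic mirror descent starts at $x^0=\operatorname{argmin}_{x\in Q}d(x)$ and runs for $k=0,\dots,N-1$ as follows, with samples $(\xi^k,(\xi^k_{(l)})_{l})$ that are independent over $k$. If $g^{(l)}_\delta(x^k)\le\varepsilon+\delta$ for all $l$, then $k$ is added to $I$ and $x^{k+1}=\operatorname{Mirr}(x^k,\eta\nabla f(x^k,\xi^k))$. Otherwise $k$ is added to $J$, one chooses $l(k)\in\operatorname{argmax}_{l}g^{(l)}_\delta(x^k)$ (ties are broken by a rule that depends only on $k$ and $x^k$), and $x^{k+1}=\operatorname{Mirr}(x^k,\eta\nabla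 g^{(l(k))}(x^k,\xi^k_{(l(k))}))$. Put $$\hat x=\frac1{|I|}\sum_{k\in I}x^k,\qquad \hat\lambda_l=\frac1{|I|}\,\#\{k\in J: l(k)=l\},\qquad \overline\Theta_0^2=\sup_{y\in Q}(d(y)-d(x^0)).$$ Let $\kappa(E^*)$ be the constant of Nemirovski's inequality for $E^*$, i.e. the least $\kappa\ge0$ such that $\mathbb{E}\|\sum_{i=1}^nX_i\|_*^2\le\kappa\sum_{i=1}^n\mathbb{E}\|X_i\|_*^2$ for all $n$ and all independent centered square-integrable random vectors $X_1,\dots,X_n$ in $E^*$. Then for every $\sigma\in(0,1/2)$ and every integer $N\ge1$ with $$N\ \ge\ \frac{128\,\overline\Theta_0^2M^2\,\bigl(17\log(2/\sigma)+2\kappa(E^*)\bigr)}{\varepsilon^2},$$ the pair $(\hat x,\hat\lambda)$ is a primal-dual $(\varepsilon,\varepsilon+2\delta,\sigma)$-solution: with probability at least $1-\sigma$, the set $I$ is non-empty (so that $\hat x$ and $\hat\lambda$ are defined), $\Delta(\hat x,\hat\lambda)\le\varepsilon$, and $g^{(l)}(\hat x)\le\varepsilon+2\delta$ for all $l$. 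-/

import Mathlib

open MeasureTheory ProbabilityTheory Set

noncomputable section

section Convex

variable {E : Type*} [NormedAddCommGroup E] [NormedSpace ℝ E]

/-- `s` is a subgradient at `x` of the function `h` with domain `Q`. -/
def IsSubgradientOn (Q : Set E) (h : E → ℝ) (x : E) (s : StrongDual ℝ E) : Prop :=
  ∀ y ∈ Q, h x + s (y - x) ≤ h y

/-- The points of `Q` at which `h`, as a function on `Q`, has a subgradient. -/
def subgradientDomain (Q : Set E) (h : E → ℝ) : Set E :=
  {x | x ∈ Q ∧ ∃ s : StrongDual ℝ E, IsSubgradientOn Q h x s}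

/-- `d` is a prox-function on `Q`: it is continuous and 1-strongly convex with respect to the norm
of `E`, and `gradD` is a continuous selection of its subgradients where they exist. -/
structure IsProxFunction (Q : Set E) (d : E → ℝ) (gradD : E → StrongDual ℝ E) : Prop where
  continuousOn : ContinuousOn d Q
  strongConvexOn : StrongConvexOn Q 1 d
  isSubgradientOn : ∀ x ∈ subgradientDomain Q d, IsSubgradientOn Q d x (gradD x)
  continuousOn_grad : ContinuousOn gradD (subgradientDomain Q d)

/-- The Bregman divergence `V(x, y) = d(y) - d(x) - ⟨∇d(x), y - x⟩`. -/
def bregman (d : E → ℝ) (gradD : E → StrongDual ℝ E) (x y : E) : ℝ :=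
  d y - d x - gradD x (y - x)

/-- A minimizer of `h` over `Q` (an arbitrary point if there is none). -/
def argminOn (Q : Set E) (h : E → ℝ) : E :=
  Classical.epsilon fun z => z ∈ Q ∧ IsMinOn h Q z

/-- The mirror step `Mirr(x, v) = argmin_{y ∈ Q} {⟨v, y⟩ + V(x, y)}`. -/
def mirrorStep (Q : Set E) (d : E → ℝ) (gradD : E → StrongDual ℝ E) (x : E)
    (v : StrongDual ℝ E) : E :=
  argminOn Q fun y => v y + bregman d gradD x y

/-- The dual function `φ(λ) = min_{x ∈ Q} {f(x) + ∑ l, λ_l g_l(x)}`. -/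
def dualFunction {m : ℕ} (Q : Set E) (f : E → ℝ) (g : Fin m → E → ℝ) (lam : Fin m → ℝ) : ℝ :=
  sInf ((fun x => f x + ∑ l, lam l * g l x) '' Q)

/-- The duality gap `Δ(x, λ) = f(x) - φ(λ)`. -/
def dualityGap {m : ℕ} (Q : Set E) (f : E → ℝ) (g : Fin m → E → ℝ) (x : E) (lam : Fin m → ℝ) : ℝ :=
  f x - dualFunction Q f g lam

/-- `hδ` is a `δ`-approximation of `h` on `Q`. -/
def IsDeltaApprox (Q : Set E) (δ : ℝ) (h hδ : E → ℝ) : Prop :=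
  ∀ x ∈ Q, |hδ x - h x| ≤ δ

/-- `G x ξ`, with `ξ` of law `P`, is an unbiased stochastic oracle, bounded by `M` almost surely in
the dual norm, for the subgradients `gradh x` of the function `h` on `Q`. -/
structure IsStochasticSubgradient [MeasurableSpace E] {Ξ : Type*} [MeasurableSpace Ξ]
    (Q : Set E) (h : E → ℝ) (gradh : E → StrongDual ℝ E) (P : Measure Ξ)
    (G : E → Ξ → StrongDual ℝ E) (M : ℝ) : Prop where
  isSubgradientOn : ∀ x ∈ Q, IsSubgradientOn Q h x (gradh x)
  measurable : Measurable fun p : Q × Ξ => G p.1 p.2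
  unbiased : ∀ x ∈ Q, ∫ ξ, G x ξ ∂P = gradh x
  bounded : ∀ x ∈ Q, ∀ᵐ ξ ∂P, ‖G x ξ‖ ≤ M

end Convex

section Nemirovski

/-- Nemirovski's inequality with constant `κ` in the normed space `B`:
`𝔼‖X₁ + ⋯ + Xₙ‖² ≤ κ (𝔼‖X₁‖² + ⋯ + 𝔼‖Xₙ‖²)` for all `n` and all independent, centered, square
integrable random vectors `X₁, …, Xₙ` in `B`. -/
def NemirovskiInequality (B : Type*) [NormedAddCommGroup B] [NormedSpace ℝ B] [MeasurableSpace B]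
    (κ : ℝ) : Prop :=
  ∀ (Ω : Type) [MeasurableSpace Ω] (μ : Measure Ω) [IsProbabilityMeasure μ] (n : ℕ)
    (X : Fin n → Ω → B),
    (∀ i, Measurable (X i)) → (∀ i, MemLp (X i) 2 μ) → (∀ i, ∫ ω, X i ω ∂μ = 0) →
    iIndepFun X μ →
    ∫ ω, ‖∑ i, X i ω‖ ^ 2 ∂μ ≤ κ * ∑ i, ∫ ω, ‖X i ω‖ ^ 2 ∂μ

/-- The constant `κ(B)` of Nemirovski's inequality: the least `κ ≥ 0` for which it holds. -/
def nemirovskiConst (B : Type*) [NormedAddCommGroup B] [NormedSpace ℝ B] [MeasurableSpace B] : ℝ :=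
  sInf {κ : ℝ | 0 ≤ κ ∧ NemirovskiInequality B κ}

end Nemirovski

/-- Everything that stochastic mirror descent with `m` noisy constraints has access to: the feasible
set `Q`, the prox-function `d` with its selection `gradD` of subgradients, the approximate
constraints `gδ l`, the stochastic subgradients `Gf x ξ` of the objective and `Gg l x ξ` of the
constraints, the rule `pick` that breaks ties in the choice of a maximizing index `l` of `gδ l x`
at step `k`, the accuracies `ε` and `δ`, and the constant `M`. -/
structure MirrorDescent (E : Type*) [NormedAddCommGroup E] [NormedSpace ℝ E] (m : ℕ)
    (Ξf : Type*) (Ξg : Fin m → Type*) where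
  Q : Set E
  d : E → ℝ
  gradD : E → StrongDual ℝ E
  gδ : Fin m → E → ℝ
  Gf : E → Ξf → StrongDual ℝ E
  Gg : (l : Fin m) → E → Ξg l → StrongDual ℝ E
  pick : ℕ → E → Fin m
  ε : ℝ
  δ : ℝ
  M : ℝ

namespace MirrorDescent

variable {E : Type*} [NormedAddCommGroup E] [NormedSpace ℝ E] {m : ℕ}
  {Ξf : Type*} {Ξg : Fin m → Type*}

/-- The constant stepsize `η = ε / M²`. -/
def η (A : MirrorDescent E m Ξf Ξg) : ℝ := A.ε / A.M ^ 2

/-- The starting point `x⁰ = argmin_{x ∈ Q} d(x)`. -/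
def x₀ (A : MirrorDescent E m Ξf Ξg) : E := argminOn A.Q A.d

/-- A step from `x` is productive if all approximate constraints are at most `ε + δ` at `x`. -/
def Productive (A : MirrorDescent E m Ξf Ξg) (x : E) : Prop := ∀ l, A.gδ l x ≤ A.ε + A.δ

open Classical in
/-- The iterates `xᵏ` of the method, where `u k = (ξᵏ, (ξᵏ_(l))_l)` is the realization of the
randomness of the oracles at step `k`. -/
def iterate (A : MirrorDescent E m Ξf Ξg) (u : ℕ → Ξf × (∀ l, Ξg l)) : ℕ → E
  | 0 => A.x₀
  | k + 1 =>
    if A.Productive (iterate A u k) then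
      mirrorStep A.Q A.d A.gradD (iterate A u k) (A.η • A.Gf (iterate A u k) (u k).1)
    else
      mirrorStep A.Q A.d A.gradD (iterate A u k)
        (A.η • A.Gg (A.pick k (iterate A u k)) (iterate A u k)
          ((u k).2 (A.pick k (iterate A u k))))

open Classical in
/-- The set `I` of productive steps among the first `N`. -/
def productiveSteps (A : MirrorDescent E m Ξf Ξg) (u : ℕ → Ξf × (∀ l, Ξg l)) (N : ℕ) : Finset ℕ :=
  (Finset.range N).filter fun k => A.Productive (A.iterate u k)

open Classical in
/-- The set `J` of non-productive steps among the first `N`. -/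
def nonproductiveSteps (A : MirrorDescent E m Ξf Ξg) (u : ℕ → Ξf × (∀ l, Ξg l)) (N : ℕ) :
    Finset ℕ :=
  (Finset.range N).filter fun k => ¬ A.Productive (A.iterate u k)

/-- The output `x̂ = (1/|I|) ∑_{k ∈ I} xᵏ`. -/
def xHat (A : MirrorDescent E m Ξf Ξg) (u : ℕ → Ξf × (∀ l, Ξg l)) (N : ℕ) : E :=
  (1 / ((A.productiveSteps u N).card : ℝ)) • ∑ k ∈ A.productiveSteps u N, A.iterate u k

/-- The dual estimate `λ̂_l = (1/|I|) #{k ∈ J : l(k) = l}`. -/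
def lamHat (A : MirrorDescent E m Ξf Ξg) (u : ℕ → Ξf × (∀ l, Ξg l)) (N : ℕ) (l : Fin m) : ℝ :=
  (1 / ((A.productiveSteps u N).card : ℝ)) *
    (((A.nonproductiveSteps u N).filter fun k => A.pick k (A.iterate u k) = l).card : ℝ)

/-- The constant `Θ̄₀² = sup_{y ∈ Q} (d(y) - d(x⁰))`. -/
def thetaBarSq (A : MirrorDescent E m Ξf Ξg) : ℝ :=
  sSup ((fun y => A.d y - A.d A.x₀) '' A.Q)

end MirrorDescent

end

/-! ### Subgradients of strongly convex functions and their density in `Q`. -/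

section MirrorStep

open Filter Topology

variable {E : Type*} [NormedAddCommGroup E] [NormedSpace ℝ E] {Q : Set E} {d : E → ℝ}
  {gradD : E → StrongDual ℝ E}

/-! Let `s k` be the exact subgradient behind step `k`. It suffices that, with high probability, `∑
s k (x k - x) ≤ ε N` for all `x ∈ Q` at once. A non-productive step has true violation above `ε`, so
it contributes more than `ε - g x` to the left side, with `g` the constraint used. At a Slater point
this rules out `N` non-productive steps. For general `x`, dividing by `|I|` makes the sums of `g x`
into `∑ l, λ̂ l * g l x`, and Jensen's inequality gives the duality gap
(`isPrimalDualSolution_of_sum_meanOracle_le`).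

The regret against the stochastic subgradients is controlled pathwise by the mirror descent
inequality (`sum_apply_sub_le`). What remains is the noise sum `∑ noise k (x k - x)`, needed
uniformly in `x`. A second mirror descent `y k`, driven by the noise itself, splits it as `noise k
(x k - y k) + noise k (y k - x)`. The second sum is again a regret, bounded pathwise for every `x`;
the first does not involve `x` and is a sum of bounded martingale differences, since `x k` and `y k`
depend only on the past. Azuma-Hoeffding bounds it (`hasSubgaussianMGF_sum_noise`). Of `κ(E*)` only
nonnegativity matters.

A selection `gradD` need not satisfy the first-order optimality condition on the boundary of `Q`;
its continuity supplies what is needed (`apply_sub_le`). -/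

theorem le_of_forall_le_add_mul {a b c : ℝ} (h : ∀ t ∈ Ioo (0 : ℝ) 1, a ≤ b + t * c) : a ≤ b := by
  have hlim : Tendsto (fun t : ℝ => b + t * c) (𝓝[>] 0) (𝓝 b) := by
    have : Continuous fun t : ℝ => b + t * c := by fun_prop
    simpa using (this.tendsto 0).mono_left nhdsWithin_le_nhds
  refine ge_of_tendsto hlim ?_
  filter_upwards [Ioo_mem_nhdsGT (zero_lt_one (α := ℝ))] with t ht using h t ht

theorem IsSubgradientOn.add_half_sq_norm_le (hd : StrongConvexOn Q 1 d) {x y : E} (hx : x ∈ Q)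
    (hy : y ∈ Q) {s : StrongDual ℝ E} (hs : IsSubgradientOn Q d x s) :
    d x + s (y - x) + 1 / 2 * ‖y - x‖ ^ 2 ≤ d y := by
  refine le_of_forall_le_add_mul (c := 1 / 2 * ‖y - x‖ ^ 2) fun t ht => ?_
  have h1 := hd.2 hx hy (sub_nonneg.2 ht.2.le) ht.1.le (by ring)
  have h2 := hs _ (hd.1 hx hy (sub_nonneg.2 ht.2.le) ht.1.le (by ring))
  have h3 : (1 - t) • x + t • y - x = t • (y - x) := by module
  rw [h3, map_smul] at h2
  simp only [smul_eq_mul, norm_sub_rev x y] at h1 h2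
  have h4 : t * (d x + s (y - x) + 1 / 2 * ‖y - x‖ ^ 2) ≤
      t * (d y + t * (1 / 2 * ‖y - x‖ ^ 2)) := by
    nlinarith [h1, h2]
  exact le_of_mul_le_mul_left h4 ht.1

theorem argminOn_spec {E : Type*} [NormedAddCommGroup E] {Q : Set E} {h : E → ℝ} (hQ : IsCompact Q) (hne : Q.Nonempty) (hh : ContinuousOn h Q) :
    argminOn Q h ∈ Q ∧ IsMinOn h Q (argminOn Q h) :=
  Classical.epsilon_spec (hQ.exists_isMinOn hne hh)

/-- Minimize `d` plus a large multiple of the squared Euclidean distance to `p`: the penalty is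
smooth, so the minimizer has a subgradient, and it lies close to `p`. -/
theorem exists_mem_subgradientDomain_norm_sub_lt [FiniteDimensional ℝ E] (hQ : IsCompact Q)
    (hd : ConvexOn ℝ Q d) (hdc : ContinuousOn d Q) {p : E} (hp : p ∈ Q) {r : ℝ} (hr : 0 < r) :
    ∃ q ∈ subgradientDomain Q d, ‖q - p‖ < r := by
  obtain ⟨b, hb, hbmin⟩ := hQ.exists_isMinOn ⟨p, hp⟩ hdc
  let e := toEuclidean (E := E)
  set K := ‖(e.symm : EuclideanSpace ℝ (Fin (Module.finrank ℝ E)) →L[ℝ] E)‖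
  set C := d p - d b
  have hC : 0 ≤ C := sub_nonneg.2 (hbmin hp)
  have hCK : 0 < 2 * C * K ^ 2 + 1 := by positivity
  -- Minimality will give `n * ‖q - p‖ ^ 2 ≤ 2 * C * K ^ 2`; the `+ 1` makes the resulting bound by
  -- `r` strict.
  set n := (2 * C * K ^ 2 + 1) / r ^ 2
  have hn : 0 < n := by positivity
  have hcont : ContinuousOn (fun q => d q + n / 2 * ‖e q - e p‖ ^ 2) Q := by
    refine hdc.add (Continuous.continuousOn ?_)
    fun_prop
  obtain ⟨q, hq, hqmin⟩ := hQ.exists_isMinOn ⟨p, hp⟩ hcont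
  -- The subgradient is minus the derivative of the penalty at `q`.
  refine ⟨q, ⟨hq, -(n • (innerSL ℝ (e q - e p)).comp (e : E →L[ℝ] _)), fun y hy => ?_⟩, ?_⟩
  · refine le_of_forall_le_add_mul (c := n / 2 * ‖e (y - q)‖ ^ 2) fun t ht => ?_
    have hmem := hd.1 hq hy (sub_nonneg.2 ht.2.le) ht.1.le (by ring)
    have h1 := hd.2 hq hy (sub_nonneg.2 ht.2.le) ht.1.le (by ring)
    have h2 := hqmin hmem
    have h3 : e ((1 - t) • q + t • y) - e p = (e q - e p) + t • e (y - q) := by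
      simp only [map_add, map_smul, map_sub]; module
    simp only [mem_ofPred_eq, h3, norm_add_sq_real, inner_smul_right, norm_smul, mul_pow,
      Real.norm_eq_abs, sq_abs, smul_eq_mul] at h1 h2
    simp only [neg_apply, smul_apply,
      ContinuousLinearMap.comp_apply, innerSL_apply_apply, smul_eq_mul,
      ContinuousLinearEquiv.coe_coe]
    refine le_of_mul_le_mul_left ?_ ht.1
    nlinarith [h1, h2]
  · have h1 : d q + n / 2 * ‖e q - e p‖ ^ 2 ≤ d p := by simpa using hqmin hp
    have h2 : d b ≤ d q := hbmin hq
    have h3 : ‖q - p‖ ≤ K * ‖e q - e p‖ := by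
      have := (e.symm : EuclideanSpace ℝ (Fin (Module.finrank ℝ E)) →L[ℝ] E).le_opNorm (e q - e p)
      simpa using this
    have h4 : n * ‖e q - e p‖ ^ 2 ≤ 2 * C := by simp only [C]; linarith
    have h5 : n * ‖q - p‖ ^ 2 ≤ 2 * C * K ^ 2 := by
      have : ‖q - p‖ ^ 2 ≤ K ^ 2 * ‖e q - e p‖ ^ 2 := by
        rw [← mul_pow]; gcongr
      nlinarith [mul_le_mul_of_nonneg_left this hn.le, mul_le_mul_of_nonneg_right h4 (sq_nonneg K)]
    have h6 : n * r ^ 2 = 2 * C * K ^ 2 + 1 := by simp only [n]; field_simp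
    have h7 : ‖q - p‖ ^ 2 < r ^ 2 := lt_of_mul_lt_mul_left (by linarith) hn.le
    exact lt_of_pow_lt_pow_left₀ 2 hr.le h7

/-! ### The mirror step: optimality, continuity and regret. -/

namespace IsProxFunction




theorem convexOn (hd : IsProxFunction Q d gradD) : ConvexOn ℝ Q d := by
  refine ⟨hd.strongConvexOn.1, fun x hx y hy a b ha hb hab => ?_⟩
  have := hd.strongConvexOn.2 hx hy ha hb hab
  have h2 : 0 ≤ a * b * (1 / 2 * ‖x - y‖ ^ 2) := by positivity
  linarith

/-- A continuous selection of the subgradients picks the largest one in every feasible direction. -/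
theorem apply_sub_le [FiniteDimensional ℝ E] (hQ : IsCompact Q) (hd : IsProxFunction Q d gradD)
    {z y : E} (hz : z ∈ Q) (hy : y ∈ Q) {s : StrongDual ℝ E} (hs : IsSubgradientOn Q d z s) :
    s (y - z) ≤ gradD z (y - z) := by
  set t : ℕ → ℝ := fun n => 1 / ((n : ℝ) + 1)
  have ht0 : ∀ n, 0 < t n := fun n => by positivity
  have ht1 : ∀ n, t n ≤ 1 := fun n => by
    simp only [t]; rw [div_le_one (by positivity)]; linarith [Nat.cast_nonneg (α := ℝ) n]
  have ht : Tendsto t atTop (𝓝 0) := tendsto_one_div_add_atTop_nhds_zero_nat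
  have hmem : ∀ n, (1 - t n) • z + t n • y ∈ Q := fun n =>
    hd.strongConvexOn.1 hz hy (sub_nonneg.2 (ht1 n)) (ht0 n).le (by ring)
  -- The tolerance is `t n ^ 2`, so that the error still vanishes after division by `t n`.
  choose q hq hqn using fun n => exists_mem_subgradientDomain_norm_sub_lt hQ hd.convexOn
    hd.continuousOn (hmem n) (pow_pos (ht0 n) 2)
  have hw : Tendsto (fun n => (t n)⁻¹ • (q n - z)) atTop (𝓝 (y - z)) := by
    rw [tendsto_iff_norm_sub_tendsto_zero]
    refine squeeze_zero (fun _ => norm_nonneg _) (fun n => ?_) ht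
    have h1 : (t n)⁻¹ • (q n - z) - (y - z) = (t n)⁻¹ • (q n - ((1 - t n) • z + t n • y)) := by
      have := (ht0 n).ne'
      rw [show q n - ((1 - t n) • z + t n • y) = (q n - z) - t n • (y - z) by module,
        smul_sub _ (q n - z), smul_smul, inv_mul_cancel₀ this, one_smul]
    rw [h1, norm_smul, norm_inv, Real.norm_eq_abs, abs_of_pos (ht0 n), inv_mul_le_iff₀ (ht0 n)]
    nlinarith [hqn n]
  have hqz : Tendsto q atTop (𝓝 z) := by
    have h1 : Tendsto (fun n => z + t n • ((t n)⁻¹ • (q n - z))) atTop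
        (𝓝 (z + (0 : ℝ) • (y - z))) := tendsto_const_nhds.add (ht.smul hw)
    rw [zero_smul, add_zero] at h1
    refine h1.congr fun n => ?_
    rw [smul_smul, mul_inv_cancel₀ (ht0 n).ne', one_smul, add_sub_cancel]
  have hzS : z ∈ subgradientDomain Q d := ⟨hz, s, hs⟩
  have hg : Tendsto (fun n => gradD (q n)) atTop (𝓝 (gradD z)) :=
    (hd.continuousOn_grad z hzS).tendsto.comp
      (tendsto_nhdsWithin_iff.2 ⟨hqz, Eventually.of_forall hq⟩)
  refine le_of_tendsto_of_tendsto ((s.continuous.tendsto _).comp hw) ((isBoundedBilinearMap_apply.continuous.tendsto (gradD z, y - z)).comp (hg.prodMk_nhds hw))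
    (Eventually.of_forall fun n => ?_)
  -- Monotonicity of subgradients: `s (q n - z) ≤ d (q n) - d z ≤ gradD (q n) (q n - z)`. Dividing
  -- by `t n` and letting `n → ∞`, continuity of `gradD` gives the claim.
  have h1 := hd.isSubgradientOn _ (hq n) z hz
  have h2 := hs (q n) (hq n).1
  rw [← neg_sub, map_neg] at h1
  simp only [Function.comp, map_smul, smul_eq_mul]
  exact mul_le_mul_of_nonneg_left (by linarith) (inv_nonneg.2 (ht0 n).le)

theorem half_sq_norm_le_bregman (hd : IsProxFunction Q d gradD) {x y : E}
    (hx : x ∈ subgradientDomain Q d) (hy : y ∈ Q) :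
    1 / 2 * ‖y - x‖ ^ 2 ≤ bregman d gradD x y := by
  have := (hd.isSubgradientOn x hx).add_half_sq_norm_le hd.strongConvexOn hx.1 hy
  unfold bregman
  linarith

theorem mirrorStep_isSubgradientOn (hQ : IsCompact Q) (hd : IsProxFunction Q d gradD) {x : E}
    (hx : x ∈ Q) (v : StrongDual ℝ E) :
    mirrorStep Q d gradD x v ∈ Q ∧
      IsSubgradientOn Q d (mirrorStep Q d gradD x v) (gradD x - v) := by
  have hc : ContinuousOn (fun y => v y + bregman d gradD x y) Q := by
    unfold bregman
    have := hd.continuousOn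
    fun_prop
  obtain ⟨h1, h2⟩ := argminOn_spec hQ ⟨x, hx⟩ hc
  refine ⟨h1, fun y hy => ?_⟩
  have h3 := h2 hy
  simp only [mem_ofPred_eq, bregman, map_sub] at h3
  simp only [mirrorStep, bregman, sub_apply, map_sub] at h3 ⊢
  linarith

theorem mirrorStep_mem (hQ : IsCompact Q) (hd : IsProxFunction Q d gradD) {x : E}
    (hx : x ∈ Q) (v : StrongDual ℝ E) :
    mirrorStep Q d gradD x v ∈ subgradientDomain Q d :=
  have h := mirrorStep_isSubgradientOn hQ hd hx v
  ⟨h.1, _, h.2⟩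

theorem mirrorStep_inequality [FiniteDimensional ℝ E] (hQ : IsCompact Q)
    (hd : IsProxFunction Q d gradD) {x y : E} (hx : x ∈ subgradientDomain Q d) (hy : y ∈ Q)
    (v : StrongDual ℝ E) :
    v (x - y) ≤ bregman d gradD x y - bregman d gradD (mirrorStep Q d gradD x v) y
      + 1 / 2 * ‖v‖ ^ 2 := by
  obtain ⟨hz, hs⟩ := mirrorStep_isSubgradientOn hQ hd hx.1 v
  set z := mirrorStep Q d gradD x v
  -- Optimality only says that `gradD x - v` is some subgradient at `z`; this replaces it by `gradD
  -- z`, as the three-point identity requires.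
  have h1 := hd.apply_sub_le hQ hz hy hs
  have h2 := hd.half_sq_norm_le_bregman hx hz
  have h3 : v (x - z) ≤ ‖v‖ * ‖z - x‖ := by
    rw [norm_sub_rev]; exact (le_abs_self _).trans (v.le_opNorm _)
  simp only [bregman, map_sub, sub_apply] at *
  nlinarith [sq_nonneg (‖v‖ - ‖z - x‖)]

/-- The step depends only on `gradD x - v`, as the gradient of the convex conjugate of a 1-strongly
convex function, which is 1-Lipschitz. This yields continuity of the step and hence measurability of
the iterates. -/
theorem norm_mirrorStep_sub_le (hQ : IsCompact Q) (hd : IsProxFunction Q d gradD) {x x' : E}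
    (hx : x ∈ Q) (hx' : x' ∈ Q) (v v' : StrongDual ℝ E) :
    ‖mirrorStep Q d gradD x v - mirrorStep Q d gradD x' v'‖ ≤
      ‖(gradD x - v) - (gradD x' - v')‖ := by
  obtain ⟨hz, hs⟩ := mirrorStep_isSubgradientOn hQ hd hx v
  obtain ⟨hz', hs'⟩ := mirrorStep_isSubgradientOn hQ hd hx' v'
  set z := mirrorStep Q d gradD x v
  set z' := mirrorStep Q d gradD x' v'
  have h1 := hs.add_half_sq_norm_le hd.strongConvexOn hz hz'
  have h2 := hs'.add_half_sq_norm_le hd.strongConvexOn hz' hz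
  have h3 : ((gradD x - v) - (gradD x' - v')) (z - z') ≤
      ‖(gradD x - v) - (gradD x' - v')‖ * ‖z - z'‖ :=
    (le_abs_self _).trans (((gradD x - v) - (gradD x' - v')).le_opNorm _)
  rw [sub_apply] at h3
  rw [norm_sub_rev, ← neg_sub z z', map_neg] at h1
  by_contra! hlt
  have h4 : 0 < ‖z - z'‖ := (norm_nonneg _).trans_lt hlt
  nlinarith [mul_lt_mul_of_pos_right hlt h4]

theorem continuous_mirrorStep (hQ : IsCompact Q) (hd : IsProxFunction Q d gradD) :
    Continuous fun p : subgradientDomain Q d × StrongDual ℝ E =>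
      mirrorStep Q d gradD p.1 p.2 := by
  have hg : Continuous fun x : subgradientDomain Q d => gradD x :=
    continuousOn_iff_continuous_domRestrict.1 hd.continuousOn_grad
  have hw : Continuous fun p : subgradientDomain Q d × StrongDual ℝ E => gradD p.1 - p.2 :=
    (hg.comp continuous_fst).sub continuous_snd
  rw [continuous_iff_continuousAt]
  intro p
  rw [ContinuousAt, tendsto_iff_norm_sub_tendsto_zero]
  exact squeeze_zero (fun _ => norm_nonneg _)
    (fun p' => hd.norm_mirrorStep_sub_le hQ p'.1.2.1 p.1.2.1 p'.2 p.2)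
    (tendsto_iff_norm_sub_tendsto_zero.1 (hw.tendsto p))

theorem argminOn_isSubgradientOn (hQ : IsCompact Q) (hne : Q.Nonempty)
    (hd : IsProxFunction Q d gradD) :
    argminOn Q d ∈ Q ∧ IsSubgradientOn Q d (argminOn Q d) 0 := by
  obtain ⟨h1, h2⟩ := argminOn_spec hQ hne hd.continuousOn
  exact ⟨h1, fun y hy => by simpa using h2 hy⟩

theorem argminOn_mem (hQ : IsCompact Q) (hne : Q.Nonempty) (hd : IsProxFunction Q d gradD) :
    argminOn Q d ∈ subgradientDomain Q d :=
  have h := hd.argminOn_isSubgradientOn hQ hne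
  ⟨h.1, _, h.2⟩

/-- `gradD` need not vanish at the minimizer, but it dominates the subgradient `0` in feasible
directions. -/
theorem bregman_argminOn_le [FiniteDimensional ℝ E] (hQ : IsCompact Q)
    (hd : IsProxFunction Q d gradD) {y : E} (hy : y ∈ Q) :
    bregman d gradD (argminOn Q d) y ≤ d y - d (argminOn Q d) := by
  obtain ⟨h1, h2⟩ := hd.argminOn_isSubgradientOn hQ ⟨y, hy⟩
  have := hd.apply_sub_le hQ h1 hy h2
  rw [zero_apply] at this
  unfold bregman
  linarith

/-- The regret bound of mirror descent. -/
theorem sum_apply_sub_le [FiniteDimensional ℝ E] (hQ : IsCompact Q)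
    (hd : IsProxFunction Q d gradD) {y : E} (hy : y ∈ Q) {z : ℕ → E} {v : ℕ → StrongDual ℝ E}
    (hz₀ : z 0 = argminOn Q d) (hz : ∀ k, z (k + 1) = mirrorStep Q d gradD (z k) (v k)) (n : ℕ) :
    ∑ k ∈ Finset.range n, v k (z k - y) ≤
      d y - d (argminOn Q d) + ∑ k ∈ Finset.range n, 1 / 2 * ‖v k‖ ^ 2 := by
  have hmem : ∀ k, z k ∈ subgradientDomain Q d := fun k => by
    induction k with
    | zero => rw [hz₀]; exact hd.argminOn_mem hQ ⟨y, hy⟩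
    | succ k ih => rw [hz]; exact hd.mirrorStep_mem hQ ih.1 _
  have h1 : ∑ k ∈ Finset.range n, v k (z k - y) ≤
      bregman d gradD (z 0) y - bregman d gradD (z n) y +
        ∑ k ∈ Finset.range n, 1 / 2 * ‖v k‖ ^ 2 := by
    rw [← Finset.sum_range_sub' (fun k => bregman d gradD (z k) y), ← Finset.sum_add_distrib]
    refine Finset.sum_le_sum fun k _ => ?_
    rw [hz]
    exact hd.mirrorStep_inequality hQ (hmem k) hy (v k)
  have h2 := hd.bregman_argminOn_le hQ hy
  have h3 := hd.half_sq_norm_le_bregman (hmem n) hy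
  rw [← hz₀] at h2 ⊢
  nlinarith [sq_nonneg ‖y - z n‖]

end IsProxFunction

end MirrorStep

/-! ### Adapted sequences and the Azuma-Hoeffding inequality. -/

section Azuma

variable {Ω U : Type*} [MeasurableSpace U]

/-- The events determined by the random variables `u 0, …, u (k - 1)`. -/
@[reducible]
def pastSigma (u : ℕ → Ω → U) (k : ℕ) : MeasurableSpace Ω :=
  ⨆ i ∈ Iio k, MeasurableSpace.comap (u i) inferInstance

theorem pastSigma_mono (u : ℕ → Ω → U) {j k : ℕ} (h : j ≤ k) : pastSigma u j ≤ pastSigma u k :=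
  biSup_mono fun _ hi => lt_of_lt_of_le hi h

theorem measurable_pastSigma (u : ℕ → Ω → U) {i k : ℕ} (h : i < k) :
    Measurable[pastSigma u k] (u i) :=
  Measurable.of_comap_le (le_iSup₂_of_le i h le_rfl)

variable [MeasurableSpace Ω] {μ : Measure Ω} {u : ℕ → Ω → U}

theorem pastSigma_le (hu : ∀ k, Measurable (u k)) (k : ℕ) :
    pastSigma u k ≤ ‹MeasurableSpace Ω› :=
  iSup₂_le fun i _ => (hu i).comap_le

theorem indepFun_of_measurable_pastSigma (hu : ∀ k, Measurable (u k)) (hind : iIndepFun u μ)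
    {𝓩 : Type*} [MeasurableSpace 𝓩] {k : ℕ} {Z : Ω → 𝓩} (hZ : Measurable[pastSigma u k] Z) :
    IndepFun Z (u k) μ := by
  have h := indep_iSup_of_disjoint (fun i => (hu i).comap_le) hind
    (S := Iio k) (T := {k}) (by simp)
  rw [IndepFun_iff_Indep]
  refine indep_of_indep_of_le_left (indep_of_indep_of_le_right h ?_) hZ.comap_le
  exact le_iSup₂_of_le k rfl le_rfl

/-- By independence `(Z, u k)` has a product law, so a property that holds almost surely for each
frozen `z` survives inserting the random `Z`. -/
theorem ae_of_measurable_pastSigma [IsProbabilityMeasure μ] (hu : ∀ k, Measurable (u k))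
    (hind : iIndepFun u μ) {𝓩 : Type*} [MeasurableSpace 𝓩] {k : ℕ} {Z : Ω → 𝓩}
    (hZ : Measurable[pastSigma u k] Z) {p : 𝓩 × U → Prop} (hp : MeasurableSet {q | p q})
    (h : ∀ z, ∀ᵐ v ∂(μ.map (u k)), p (z, v)) : ∀ᵐ ω ∂μ, p (Z ω, u k ω) := by
  have hprob : IsProbabilityMeasure (μ.map (u k)) :=
    Measure.isProbabilityMeasure_map (hu k).aemeasurable
  have hZ' : Measurable Z := hZ.mono (pastSigma_le hu k) le_rfl
  have h1 : ∀ᵐ q ∂((μ.map Z).prod (μ.map (u k))), p q := by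
    rw [Measure.ae_prod_iff_ae_ae hp]
    exact Filter.Eventually.of_forall h
  rw [← (indepFun_iff_map_prod_eq_prod_map_map hZ'.aemeasurable (hu k).aemeasurable).1
    (indepFun_of_measurable_pastSigma hu hind hZ)] at h1
  exact ae_of_ae_map (hZ'.prodMk (hu k)).aemeasurable h1

/-- The **Azuma-Hoeffding inequality** for martingale differences `ψ k (Z k) (u k)`, where `u` is an
independent sequence and `Z k` is determined by `u 0, …, u (k - 1)`. -/
theorem hasSubgaussianMGF_sum_range [IsProbabilityMeasure μ] (hu : ∀ k, Measurable (u k))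
    (hind : iIndepFun u μ) {𝓩 : Type*} [MeasurableSpace 𝓩] {Z : ℕ → Ω → 𝓩}
    (hZ : ∀ k, Measurable[pastSigma u k] (Z k)) {ψ : ℕ → 𝓩 × U → ℝ}
    (hψ : ∀ k, Measurable (ψ k)) {c : NNReal}
    (hbound : ∀ k z, ∀ᵐ v ∂(μ.map (u k)), |ψ k (z, v)| ≤ c)
    (hmean : ∀ k z, ∫ v, ψ k (z, v) ∂(μ.map (u k)) = 0) (n : ℕ) :
    HasSubgaussianMGF (fun ω => ∑ k ∈ Finset.range n, ψ k (Z k ω, u k ω)) (n * c ^ 2) μ := by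
  have hprob : ∀ k, IsProbabilityMeasure (μ.map (u k)) := fun k =>
    Measure.isProbabilityMeasure_map (hu k).aemeasurable
  have hZ' : ∀ k, Measurable (Z k) := fun k => (hZ k).mono (pastSigma_le hu k) le_rfl
  have hD : ∀ k, Measurable fun ω => ψ k (Z k ω, u k ω) := fun k =>
    (hψ k).comp ((hZ' k).prodMk (hu k))
  have hDb : ∀ k, ∀ᵐ ω ∂μ, |ψ k (Z k ω, u k ω)| ≤ c := fun k =>
    ae_of_measurable_pastSigma hu hind (hZ k) (measurableSet_le (hψ k).abs measurable_const)
      (hbound k)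
  have hsub : ∀ k z, HasSubgaussianMGF (fun v => ψ k (z, v)) (c ^ 2) (μ.map (u k)) := by
    intro k z
    have h := hasSubgaussianMGF_of_mem_Icc_of_integral_eq_zero (a := -(c : ℝ)) (b := c)
      (((hψ k).comp measurable_prodMk_left).aemeasurable (μ := μ.map (u k)) (f := fun v => ψ k (z, v)))
      (by filter_upwards [hbound k z] with v hv using abs_le.1 hv) (hmean k z)
    convert h using 2
    ext
    push_cast
    rw [sub_neg_eq_add, ← two_mul, norm_mul]
    simp
  have hTb : ∀ n : ℕ, ∀ᵐ ω ∂μ, ∑ k ∈ Finset.range n, ψ k (Z k ω, u k ω) ∈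
      Icc (-((n : ℝ) * c)) ((n : ℝ) * c) := by
    intro n
    filter_upwards [ae_all_iff.2 hDb] with ω hω
    rw [mem_Icc, ← abs_le]
    refine (Finset.abs_sum_le_sum_abs _ _).trans ((Finset.sum_le_sum fun k _ => hω k).trans ?_)
    simp
  have hTm : ∀ n : ℕ, Measurable fun ω => ∑ k ∈ Finset.range n, ψ k (Z k ω, u k ω) := fun n =>
    Finset.measurable_fun_sum _ fun k _ => hD k
  have hint : ∀ (n : ℕ) (t : ℝ), Integrable
      (fun ω => Real.exp (t * ∑ k ∈ Finset.range n, ψ k (Z k ω, u k ω))) μ := fun n t =>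
    integrable_exp_mul_of_mem_Icc (hTm n).aemeasurable (hTb n)
  refine ⟨hint n, fun t => ?_⟩
  induction n with
  | zero => simp [mgf]
  | succ n ih =>
    set T : Ω → ℝ := fun ω => ∑ k ∈ Finset.range n, ψ k (Z k ω, u k ω) with hT
    have hTpast : Measurable[pastSigma u n] T := by
      refine Finset.measurable_fun_sum _ fun k hk => (hψ k).comp ?_
      have hk' := Finset.mem_range.1 hk
      exact ((hZ k).mono (pastSigma_mono u hk'.le) le_rfl).prodMk (measurable_pastSigma u hk')
    have hW : Measurable fun ω => (Z n ω, T ω) := (hZ' n).prodMk (hTm n)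
    -- The product law replaces conditional expectations: Fubini integrates out `u n` with the past
    -- frozen, and Hoeffding's lemma applies on each fibre.
    have hlawW : μ.map (fun ω => ((Z n ω, T ω), u n ω)) =
        (μ.map (fun ω => (Z n ω, T ω))).prod (μ.map (u n)) :=
      (indepFun_iff_map_prod_eq_prod_map_map hW.aemeasurable (hu n).aemeasurable).1
        (indepFun_of_measurable_pastSigma hu hind ((hZ n).prodMk hTpast))
    let F : (𝓩 × ℝ) × U → ℝ := fun p => Real.exp (t * (p.1.2 + ψ n (p.1.1, p.2)))
    have hF : Measurable F := by
      have := hψ n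
      fun_prop
    have hFint : Integrable F ((μ.map (fun ω => (Z n ω, T ω))).prod (μ.map (u n))) := by
      rw [← hlawW, integrable_map_measure hF.aestronglyMeasurable (hW.prodMk (hu n)).aemeasurable]
      simpa [Finset.sum_range_succ, Function.comp_def, F, hT] using hint (n + 1) t
    have h1 : mgf (fun ω => ∑ k ∈ Finset.range (n + 1), ψ k (Z k ω, u k ω)) μ t =
        ∫ p, F p ∂((μ.map (fun ω => (Z n ω, T ω))).prod (μ.map (u n))) := by
      rw [← hlawW, integral_map (hW.prodMk (hu n)).aemeasurable hF.aestronglyMeasurable]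
      simp only [mgf, Finset.sum_range_succ, F, hT]
    have h2 : ∀ w, ∫ v, F (w, v) ∂(μ.map (u n)) ≤
        Real.exp (t * w.2) * Real.exp (c ^ 2 * t ^ 2 / 2) := by
      intro w
      have := (hsub n w.1).mgf_le t
      simp only [F, mul_add, Real.exp_add, integral_const_mul]
      refine mul_le_mul_of_nonneg_left ?_ (Real.exp_nonneg _)
      simpa [mgf] using this
    have hTint : Integrable (fun w : 𝓩 × ℝ => Real.exp (t * w.2) * Real.exp (c ^ 2 * t ^ 2 / 2))
        (μ.map (fun ω => (Z n ω, T ω))) := by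
      rw [integrable_map_measure (by fun_prop) hW.aemeasurable]
      exact (hint n t).mul_const _
    rw [h1, integral_prod _ hFint]
    refine (integral_mono hFint.integral_prod_left hTint h2).trans ?_
    rw [integral_map hW.aemeasurable (by fun_prop), integral_mul_const]
    refine (mul_le_mul_of_nonneg_right ih (Real.exp_nonneg _)).trans (le_of_eq ?_)
    rw [← Real.exp_add]
    push_cast
    ring_nf

end Azuma

/-! ### Pathwise analysis of the method. -/

namespace MirrorDescent

section Deterministic

variable {E : Type*} [NormedAddCommGroup E] [NormedSpace ℝ E] {m : ℕ}
  {Ξf : Type*} {Ξg : Fin m → Type*}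

open Classical in
/-- The stochastic subgradient that the method uses when its `k`-th iterate is `x`. -/
noncomputable def oracle (A : MirrorDescent E m Ξf Ξg) (k : ℕ) (x : E) (v : Ξf × (∀ l, Ξg l)) :
    StrongDual ℝ E :=
  if A.Productive x then A.Gf x v.1 else A.Gg (A.pick k x) x (v.2 (A.pick k x))

open Classical in
/-- The subgradient that `oracle` estimates. -/
noncomputable def meanOracle (A : MirrorDescent E m Ξf Ξg) (gradf : E → StrongDual ℝ E)
    (gradg : Fin m → E → StrongDual ℝ E) (k : ℕ) (x : E) : StrongDual ℝ E :=
  if A.Productive x then gradf x else gradg (A.pick k x) x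

theorem iterate_succ (A : MirrorDescent E m Ξf Ξg) (u : ℕ → Ξf × (∀ l, Ξg l)) (k : ℕ) :
    A.iterate u (k + 1) = mirrorStep A.Q A.d A.gradD (A.iterate u k)
      (A.η • A.oracle k (A.iterate u k) (u k)) := by
  rw [iterate, oracle]
  split_ifs <;> rfl

/-- The noise of the oracle at step `k`. -/
noncomputable def noise (A : MirrorDescent E m Ξf Ξg) (gradf : E → StrongDual ℝ E)
    (gradg : Fin m → E → StrongDual ℝ E) (k : ℕ) (x : E) (v : Ξf × (∀ l, Ξg l)) :
    StrongDual ℝ E :=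
  A.meanOracle gradf gradg k x - A.oracle k x v

/-- The iterates of mirror descent with stepsize `η / 8`, driven by the noise of the oracles. -/
noncomputable def noiseIterate (A : MirrorDescent E m Ξf Ξg) (gradf : E → StrongDual ℝ E)
    (gradg : Fin m → E → StrongDual ℝ E) (u : ℕ → Ξf × (∀ l, Ξg l)) : ℕ → E
  | 0 => A.x₀
  | k + 1 => mirrorStep A.Q A.d A.gradD (noiseIterate A gradf gradg u k)
      ((A.η / 8) • A.noise gradf gradg k (A.iterate u k) (u k))

variable {A : MirrorDescent E m Ξf Ξg} {gradf : E → StrongDual ℝ E}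
  {gradg : Fin m → E → StrongDual ℝ E} {u : ℕ → Ξf × (∀ l, Ξg l)}

theorem iterate_mem (hQ : IsCompact A.Q) (hne : A.Q.Nonempty)
    (hprox : IsProxFunction A.Q A.d A.gradD) (u : ℕ → Ξf × (∀ l, Ξg l)) (k : ℕ) :
    A.iterate u k ∈ subgradientDomain A.Q A.d := by
  induction k with
  | zero => exact hprox.argminOn_mem hQ hne
  | succ k ih => rw [iterate_succ]; exact hprox.mirrorStep_mem hQ ih.1 _

theorem noiseIterate_mem (hQ : IsCompact A.Q) (hne : A.Q.Nonempty)
    (hprox : IsProxFunction A.Q A.d A.gradD) (u : ℕ → Ξf × (∀ l, Ξg l)) (k : ℕ) :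
    A.noiseIterate gradf gradg u k ∈ subgradientDomain A.Q A.d := by
  induction k with
  | zero => exact hprox.argminOn_mem hQ hne
  | succ k ih => exact hprox.mirrorStep_mem hQ ih.1 _

theorem sub_le_thetaBarSq (hQ : IsCompact A.Q) (hprox : IsProxFunction A.Q A.d A.gradD) {y : E}
    (hy : y ∈ A.Q) : A.d y - A.d A.x₀ ≤ A.thetaBarSq :=
  le_csSup (hQ.bddAbove_image (hprox.continuousOn.sub continuousOn_const)) ⟨y, hy, rfl⟩

theorem thetaBarSq_nonneg (hQ : IsCompact A.Q) (hne : A.Q.Nonempty)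
    (hprox : IsProxFunction A.Q A.d A.gradD) : 0 ≤ A.thetaBarSq := by
  have h := sub_le_thetaBarSq hQ hprox (y := A.x₀) (hprox.argminOn_isSubgradientOn hQ hne).1
  rwa [sub_self] at h

/-- Strong convexity puts `Q` in the ball of radius `√(2 Θ̄₀²)` about `x₀`, so its diameter is at
most twice that. -/
theorem sq_norm_sub_le (hQ : IsCompact A.Q) (hprox : IsProxFunction A.Q A.d A.gradD) {x y : E}
    (hx : x ∈ A.Q) (hy : y ∈ A.Q) : ‖x - y‖ ^ 2 ≤ 8 * A.thetaBarSq := by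
  have h : ∀ z ∈ A.Q, ‖z - A.x₀‖ ^ 2 ≤ 2 * A.thetaBarSq := fun z hz => by
    obtain ⟨h1, h2⟩ := hprox.argminOn_isSubgradientOn hQ ⟨z, hz⟩
    have h3 := h2.add_half_sq_norm_le hprox.strongConvexOn h1 hz
    have h4 := sub_le_thetaBarSq hQ hprox hz
    rw [zero_apply] at h3
    unfold x₀ at *
    linarith
  have h1 : ‖x - y‖ ≤ ‖x - A.x₀‖ + ‖y - A.x₀‖ := by
    rw [norm_sub_rev y]; exact norm_sub_le_norm_sub_add_norm_sub _ _ _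
  nlinarith [h x hx, h y hy, norm_nonneg (x - y), sq_nonneg (‖x - A.x₀‖ - ‖y - A.x₀‖)]

/-- If the noise correlates little with the iterates, mirror descent has small linearized regret
with respect to the exact subgradients. -/
theorem sum_meanOracle_le [FiniteDimensional ℝ E] (hM : 0 < A.M) (hε : 0 < A.ε)
    (hQ : IsCompact A.Q) (hprox : IsProxFunction A.Q A.d A.gradD)
    (hmean : ∀ k, ∀ x ∈ A.Q, ‖A.meanOracle gradf gradg k x‖ ≤ A.M)
    (horacle : ∀ k, ‖A.oracle k (A.iterate u k) (u k)‖ ≤ A.M) {x : E} (hx : x ∈ A.Q) (N : ℕ) :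
    ∑ k ∈ Finset.range N, A.meanOracle gradf gradg k (A.iterate u k) (A.iterate u k - x) ≤
      9 * A.thetaBarSq * A.M ^ 2 / A.ε + 3 / 4 * A.ε * N +
      ∑ k ∈ Finset.range N, A.noise gradf gradg k (A.iterate u k) (u k)
        (A.iterate u k - A.noiseIterate gradf gradg u k) := by
  have hη : 0 < A.η := div_pos hε (by positivity)
  have hηM : A.η * A.M ^ 2 = A.ε := by unfold η; field_simp
  have hΘ := sub_le_thetaBarSq hQ hprox hx
  have hnoise : ∀ k, ‖A.noise gradf gradg k (A.iterate u k) (u k)‖ ≤ 2 * A.M := fun k => by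
    refine (norm_sub_le _ _).trans ?_
    linarith [horacle k, hmean k _ (iterate_mem hQ ⟨x, hx⟩ hprox u k).1]
  have h1 := hprox.sum_apply_sub_le hQ hx (z := A.iterate u)
    (v := fun k => A.η • A.oracle k (A.iterate u k) (u k)) rfl (iterate_succ A u) N
  have h2 := hprox.sum_apply_sub_le hQ hx (z := A.noiseIterate gradf gradg u)
    (v := fun k => (A.η / 8) • A.noise gradf gradg k (A.iterate u k) (u k)) rfl
    (fun _ => rfl) N
  have h3 : ∑ k ∈ Finset.range N, 1 / 2 * ‖A.η • A.oracle k (A.iterate u k) (u k)‖ ^ 2 ≤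
      A.η * (A.ε * N / 2) := by
    refine (Finset.sum_le_card_nsmul _ _ (1 / 2 * (A.η * A.M) ^ 2) fun k _ => ?_).trans_eq ?_
    · rw [norm_smul, Real.norm_of_nonneg hη.le]
      have := horacle k
      gcongr
    · rw [← hηM, Finset.card_range, nsmul_eq_mul]; ring
  have h4 : ∑ k ∈ Finset.range N,
      1 / 2 * ‖(A.η / 8) • A.noise gradf gradg k (A.iterate u k) (u k)‖ ^ 2 ≤
      A.η / 8 * (A.ε * N / 4) := by
    refine (Finset.sum_le_card_nsmul _ _ (1 / 2 * (A.η / 8 * (2 * A.M)) ^ 2) fun k _ => ?_).trans_eq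
      ?_
    · rw [norm_smul, Real.norm_of_nonneg (by positivity)]
      have := hnoise k
      gcongr
    · rw [← hηM, Finset.card_range, nsmul_eq_mul]; ring
  have h5 : A.thetaBarSq = A.η * (A.thetaBarSq * A.M ^ 2 / A.ε) := by
    rw [← hηM]; field_simp
  simp only [smul_apply, smul_eq_mul, ← Finset.mul_sum] at h1 h2 h3 h4
  unfold x₀ at hΘ
  have h6 : ∑ k ∈ Finset.range N, A.oracle k (A.iterate u k) (u k) (A.iterate u k - x) ≤
      A.thetaBarSq * A.M ^ 2 / A.ε + A.ε * N / 2 := by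
    refine le_of_mul_le_mul_left ?_ hη
    rw [mul_add, ← h5]
    linarith
  have h7 : ∑ k ∈ Finset.range N, A.noise gradf gradg k (A.iterate u k) (u k)
      (A.noiseIterate gradf gradg u k - x) ≤
      8 * (A.thetaBarSq * A.M ^ 2 / A.ε) + A.ε * N / 4 := by
    refine le_of_mul_le_mul_left ?_ (show 0 < A.η / 8 by positivity)
    rw [mul_add, show A.η / 8 * (8 * (A.thetaBarSq * A.M ^ 2 / A.ε)) = A.thetaBarSq by
      rw [← mul_assoc, div_mul_cancel₀ _ (by norm_num), ← h5]]
    linarith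
  -- Exact subgradient = oracle + noise, with the noise term split at the auxiliary iterate.
  have h8 : ∑ k ∈ Finset.range N, A.meanOracle gradf gradg k (A.iterate u k) (A.iterate u k - x) =
      ∑ k ∈ Finset.range N, A.oracle k (A.iterate u k) (u k) (A.iterate u k - x) +
      ∑ k ∈ Finset.range N, A.noise gradf gradg k (A.iterate u k) (u k)
        (A.iterate u k - A.noiseIterate gradf gradg u k) +
      ∑ k ∈ Finset.range N, A.noise gradf gradg k (A.iterate u k) (u k)
        (A.noiseIterate gradf gradg u k - x) := by
    rw [add_assoc, ← Finset.sum_add_distrib, ← Finset.sum_add_distrib]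
    refine Finset.sum_congr rfl fun k _ => ?_
    rw [← map_add, sub_add_sub_cancel, noise, sub_apply, add_sub_cancel]
  rw [h8, show 9 * A.thetaBarSq * A.M ^ 2 / A.ε = 9 * (A.thetaBarSq * A.M ^ 2 / A.ε) by ring]
  linarith

/-- Small linearized regret makes the output of the method a primal-dual solution. -/
theorem isPrimalDualSolution_of_sum_meanOracle_le (f : E → ℝ) (g : Fin m → E → ℝ)
    (hQ : IsCompact A.Q) (hprox : IsProxFunction A.Q A.d A.gradD)
    (hf : ConvexOn ℝ A.Q f) (hg : ∀ l, ConvexOn ℝ A.Q (g l))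
    (hSlater : ∃ x ∈ A.Q, ∀ l, g l x < 0)
    (hgδ : ∀ l, IsDeltaApprox A.Q A.δ (g l) (A.gδ l))
    (hpick : ∀ k, ∀ x ∈ A.Q, ∀ l, A.gδ l x ≤ A.gδ (A.pick k x) x)
    (hgradf : ∀ x ∈ A.Q, IsSubgradientOn A.Q f x (gradf x))
    (hgradg : ∀ l, ∀ x ∈ A.Q, IsSubgradientOn A.Q (g l) x (gradg l x))
    {N : ℕ} (hN : 1 ≤ N)
    (hsum : ∀ x ∈ A.Q, ∑ k ∈ Finset.range N,
      A.meanOracle gradf gradg k (A.iterate u k) (A.iterate u k - x) ≤ A.ε * N) :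
    (A.productiveSteps u N).Nonempty ∧
      dualityGap A.Q f g (A.xHat u N) (A.lamHat u N) ≤ A.ε ∧
      ∀ l, g l (A.xHat u N) ≤ A.ε + 2 * A.δ := by
  classical
  obtain ⟨xS, hxS, hxS'⟩ := hSlater
  have hmem : ∀ k, A.iterate u k ∈ A.Q := fun k => (iterate_mem hQ ⟨xS, hxS⟩ hprox u k).1
  have hI : ∀ k ∈ A.productiveSteps u N, A.Productive (A.iterate u k) := fun k hk => by
    rw [productiveSteps, Finset.mem_filter] at hk; exact hk.2
  have hJ : ∀ k ∈ A.nonproductiveSteps u N, ¬ A.Productive (A.iterate u k) := fun k hk => by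
    rw [nonproductiveSteps, Finset.mem_filter] at hk; exact hk.2
  have hcard : (A.productiveSteps u N).card + (A.nonproductiveSteps u N).card = N := by
    rw [productiveSteps, nonproductiveSteps]
    simpa using Finset.card_filter_add_card_filter_not
      (s := Finset.range N) (fun k => A.Productive (A.iterate u k))
  have hcard' : ((A.productiveSteps u N).card : ℝ) + (A.nonproductiveSteps u N).card = N :=
    mod_cast hcard
  have hviol : ∀ k ∈ A.nonproductiveSteps u N,
      A.ε < g (A.pick k (A.iterate u k)) (A.iterate u k) := fun k hk => by
    have h1 := hJ k hk
    simp only [Productive, not_forall, not_le] at h1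
    obtain ⟨l, hl⟩ := h1
    have h2 := hpick k _ (hmem k) l
    have h3 := (abs_le.1 (hgδ (A.pick k (A.iterate u k)) _ (hmem k))).2
    linarith
  have hterm : ∀ x ∈ A.Q, ∀ k ∈ A.nonproductiveSteps u N,
      A.ε - g (A.pick k (A.iterate u k)) x <
        A.meanOracle gradf gradg k (A.iterate u k) (A.iterate u k - x) := fun x hx k hk => by
    have h1 := hgradg (A.pick k (A.iterate u k)) _ (hmem k) x hx
    have h2 := hviol k hk
    rw [meanOracle, if_neg (hJ k hk), ← neg_sub x, map_neg]
    linarith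
  have hsplit : ∀ x ∈ A.Q,
      ∑ k ∈ A.productiveSteps u N, (f (A.iterate u k) - f x) +
        ∑ k ∈ A.nonproductiveSteps u N, A.meanOracle gradf gradg k (A.iterate u k)
          (A.iterate u k - x) ≤ A.ε * N := fun x hx => by
    refine le_trans ?_ (hsum x hx)
    rw [← Finset.sum_filter_add_sum_filter_not (Finset.range N)
      (fun k => A.Productive (A.iterate u k)), productiveSteps, nonproductiveSteps]
    gcongr with k hk
    have h1 := hgradf _ (hmem k) x hx
    rw [meanOracle, if_pos (Finset.mem_filter.1 hk).2, ← neg_sub x, map_neg]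
    linarith
  -- Otherwise each of the `N` terms exceeds `ε` at the Slater point, against the bound `ε N`.
  have hne : (A.productiveSteps u N).Nonempty := by
    by_contra hem
    rw [Finset.not_nonempty_iff_eq_empty] at hem
    rw [hem, Finset.card_empty, zero_add] at hcard
    have h1 := hsplit xS hxS
    have h2 : ∑ _k ∈ A.nonproductiveSteps u N, A.ε = A.ε * N := by
      rw [Finset.sum_const, hcard, nsmul_eq_mul, mul_comm]
    rw [hem, Finset.sum_empty, zero_add, ← h2] at h1
    refine h1.not_gt (Finset.sum_lt_sum_of_nonempty (Finset.card_pos.1 (hN.trans_eq hcard.symm))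
      fun k hk => ?_)
    linarith [hterm xS hxS k hk, hxS' (A.pick k (A.iterate u k))]
  have hcpos : 0 < ((A.productiveSteps u N).card : ℝ) := mod_cast Finset.card_pos.2 hne
  have hw : ∑ k ∈ A.productiveSteps u N, 1 / ((A.productiveSteps u N).card : ℝ) = 1 := by
    rw [Finset.sum_const, nsmul_eq_mul]; field_simp
  have hjensen : ∀ h : E → ℝ, ConvexOn ℝ A.Q h → h (A.xHat u N) ≤
      1 / ((A.productiveSteps u N).card : ℝ) * ∑ k ∈ A.productiveSteps u N, h (A.iterate u k) :=
    fun h hh => by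
    have := hh.map_sum_le (t := A.productiveSteps u N)
      (w := fun _ => 1 / ((A.productiveSteps u N).card : ℝ)) (p := A.iterate u)
      (fun _ _ => by positivity) hw (fun k _ => hmem k)
    rw [← Finset.smul_sum, ← Finset.smul_sum] at this
    exact this
  refine ⟨hne, ?_, fun l => ?_⟩
  · rw [dualityGap, sub_le_comm]
    refine le_csInf ⟨_, xS, hxS, rfl⟩ ?_
    rintro _ ⟨x, hx, rfl⟩
    have h1 : ∑ k ∈ A.nonproductiveSteps u N, (A.ε - g (A.pick k (A.iterate u k)) x) ≤
        ∑ k ∈ A.nonproductiveSteps u N, A.meanOracle gradf gradg k (A.iterate u k)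
          (A.iterate u k - x) :=
      Finset.sum_le_sum fun k hk => (hterm x hx k hk).le
    -- Grouping the non-productive steps by the constraint used turns their counts into the
    -- multipliers.
    have h2 : ∑ l, A.lamHat u N l * g l x = 1 / ((A.productiveSteps u N).card : ℝ) *
        ∑ k ∈ A.nonproductiveSteps u N, g (A.pick k (A.iterate u k)) x := by
      rw [← Finset.sum_fiberwise (A.nonproductiveSteps u N) (fun k => A.pick k (A.iterate u k)),
        Finset.mul_sum]
      refine Finset.sum_congr rfl fun l _ => ?_
      rw [lamHat, mul_assoc, ← nsmul_eq_mul, ← Finset.sum_const]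
      congr 1
      refine Finset.sum_congr (by congr!) fun k hk => ?_
      rw [(Finset.mem_filter.1 hk).2]
    have h3 := hsplit x hx
    have h4 := hjensen f hf
    rw [Finset.sum_sub_distrib, Finset.sum_const, nsmul_eq_mul] at h1 h3
    dsimp only
    rw [h2]
    have h5 : 1 / ((A.productiveSteps u N).card : ℝ) *
        (∑ k ∈ A.productiveSteps u N, f (A.iterate u k)) ≤
        1 / ((A.productiveSteps u N).card : ℝ) * ((A.productiveSteps u N).card * (f x + A.ε) +
          ∑ k ∈ A.nonproductiveSteps u N, g (A.pick k (A.iterate u k)) x) := by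
      refine mul_le_mul_of_nonneg_left ?_ (by positivity)
      rw [← hcard'] at h3
      linarith
    rw [mul_add, ← mul_assoc, one_div_mul_cancel hcpos.ne', one_mul] at h5
    linarith
  · refine (hjensen (g l) (hg l)).trans ?_
    rw [one_div, inv_mul_le_iff₀ hcpos, ← nsmul_eq_mul, ← Finset.sum_const]
    refine Finset.sum_le_sum fun k hk => ?_
    linarith [(abs_le.1 (hgδ l _ (hmem k))).1, hI k hk l]

end Deterministic

end MirrorDescent

/-! ### Measurability and the martingale of the noise. -/

theorem IsProxFunction.measurable_mirrorStep {E : Type*} [NormedAddCommGroup E] [NormedSpace ℝ E]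
    [FiniteDimensional ℝ E] [MeasurableSpace E] [BorelSpace E] {Q : Set E} {d : E → ℝ}
    {gradD : E → StrongDual ℝ E} (hQ : IsCompact Q) (hd : IsProxFunction Q d gradD)
    {α : Type*} {mα : MeasurableSpace α} {x : α → E} {v : α → StrongDual ℝ E} (hx : Measurable x)
    (hmem : ∀ a, x a ∈ subgradientDomain Q d) (hv : Measurable v) :
    Measurable fun a => mirrorStep Q d gradD (x a) (v a) := by
  have h := (hd.continuous_mirrorStep hQ).measurable.comp ((hx.subtype_mk (h := hmem)).prodMk hv)
  rw [Function.comp_def] at h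
  exact h

namespace MirrorDescent

section Stochastic

variable {E : Type*} [NormedAddCommGroup E] [NormedSpace ℝ E] [MeasurableSpace E]
  {m : ℕ} {Ξf : Type*} [MeasurableSpace Ξf]
  {Ξg : Fin m → Type*} [∀ l, MeasurableSpace (Ξg l)] {A : MirrorDescent E m Ξf Ξg}
  {f : E → ℝ} {g : Fin m → E → ℝ} {gradf : E → StrongDual ℝ E}
  {gradg : Fin m → E → StrongDual ℝ E} {Pf : Measure Ξf} {Pg : ∀ l, Measure (Ξg l)}

theorem measurable_oracle (hgδ_meas : ∀ l, Measurable fun x : A.Q => A.gδ l x)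
    (hpick_meas : ∀ k, Measurable fun x : A.Q => A.pick k x)
    (hGf : IsStochasticSubgradient A.Q f gradf Pf A.Gf A.M)
    (hGg : ∀ l, IsStochasticSubgradient A.Q (g l) (gradg l) (Pg l) (A.Gg l) A.M) (k : ℕ) :
    Measurable fun p : A.Q × (Ξf × (∀ l, Ξg l)) => A.oracle k p.1 p.2 := by
  classical
  have hprod : MeasurableSet {x : A.Q | A.Productive x} := by
    simp only [Productive, ofPred_forall]
    exact MeasurableSet.iInter fun l => measurableSet_le (hgδ_meas l) measurable_const
  have hg : Measurable fun q : (A.Q × (Ξf × (∀ l, Ξg l))) × Fin m =>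
      A.Gg q.2 q.1.1 (q.1.2.2 q.2) :=
    measurable_from_prod_countable_left fun l => (hGg l).measurable.comp
      (measurable_fst.prodMk ((measurable_pi_apply l).comp (measurable_snd.comp measurable_snd)))
  unfold oracle
  refine Measurable.ite (measurable_fst hprod) ?_ ?_
  · exact hGf.measurable.comp (measurable_fst.prodMk (measurable_fst.comp measurable_snd))
  · exact hg.comp (measurable_id.prodMk ((hpick_meas k).comp measurable_fst))

variable {P : Measure (Ξf × (∀ l, Ξg l))}

theorem ae_norm_oracle_le (hPf : P.map (fun v => v.1) = Pf)
    (hPg : ∀ l, P.map (fun v => v.2 l) = Pg l)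
    (hGf : IsStochasticSubgradient A.Q f gradf Pf A.Gf A.M)
    (hGg : ∀ l, IsStochasticSubgradient A.Q (g l) (gradg l) (Pg l) (A.Gg l) A.M) (k : ℕ)
    {x : E} (hx : x ∈ A.Q) : ∀ᵐ v ∂P, ‖A.oracle k x v‖ ≤ A.M := by
  unfold oracle
  split_ifs
  · have h := hGf.bounded x hx
    rw [← hPf] at h
    exact ae_of_ae_map (by fun_prop) h
  · have h := (hGg (A.pick k x)).bounded x hx
    rw [← hPg] at h
    exact ae_of_ae_map (by fun_prop) h

variable [FiniteDimensional ℝ E]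

theorem integral_oracle (hPf : P.map (fun v => v.1) = Pf) (hPg : ∀ l, P.map (fun v => v.2 l) = Pg l)
    (hGf : IsStochasticSubgradient A.Q f gradf Pf A.Gf A.M)
    (hGg : ∀ l, IsStochasticSubgradient A.Q (g l) (gradg l) (Pg l) (A.Gg l) A.M) (k : ℕ)
    {x : E} (hx : x ∈ A.Q) : ∫ v, A.oracle k x v ∂P = A.meanOracle gradf gradg k x := by
  unfold oracle meanOracle
  split_ifs
  · have hm : Measurable fun ξ => A.Gf x ξ :=
      hGf.measurable.comp (measurable_prodMk_left (x := (⟨x, hx⟩ : A.Q)))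
    rw [← hGf.unbiased x hx, ← hPf, integral_map (by fun_prop) hm.aestronglyMeasurable]
  · set l := A.pick k x
    have hm : Measurable fun ξ => A.Gg l x ξ :=
      (hGg l).measurable.comp (measurable_prodMk_left (x := (⟨x, hx⟩ : A.Q)))
    rw [← (hGg l).unbiased x hx, ← hPg, integral_map (by fun_prop) hm.aestronglyMeasurable]

theorem norm_meanOracle_le [IsProbabilityMeasure P] (hPf : P.map (fun v => v.1) = Pf)
    (hPg : ∀ l, P.map (fun v => v.2 l) = Pg l)
    (hGf : IsStochasticSubgradient A.Q f gradf Pf A.Gf A.M)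
    (hGg : ∀ l, IsStochasticSubgradient A.Q (g l) (gradg l) (Pg l) (A.Gg l) A.M) (k : ℕ)
    {x : E} (hx : x ∈ A.Q) : ‖A.meanOracle gradf gradg k x‖ ≤ A.M := by
  rw [← integral_oracle hPf hPg hGf hGg k hx]
  simpa using norm_integral_le_of_norm_le_const (ae_norm_oracle_le hPf hPg hGf hGg k hx)

theorem measurable_noise [IsProbabilityMeasure P] (hPf : P.map (fun v => v.1) = Pf)
    (hPg : ∀ l, P.map (fun v => v.2 l) = Pg l)
    (hgδ_meas : ∀ l, Measurable fun x : A.Q => A.gδ l x)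
    (hpick_meas : ∀ k, Measurable fun x : A.Q => A.pick k x)
    (hGf : IsStochasticSubgradient A.Q f gradf Pf A.Gf A.M)
    (hGg : ∀ l, IsStochasticSubgradient A.Q (g l) (gradg l) (Pg l) (A.Gg l) A.M) (k : ℕ) :
    Measurable fun p : A.Q × (Ξf × (∀ l, Ξg l)) => A.noise gradf gradg k p.1 p.2 := by
  have ho := measurable_oracle hgδ_meas hpick_meas hGf hGg k
  have hm : Measurable fun x : A.Q => A.meanOracle gradf gradg k x := by
    -- The exact subgradients are measurable in `x` because they are parametric integrals of the
    -- oracle.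
    have h := (ho.stronglyMeasurable.integral_prod_right' (ν := P)).measurable
    have heq : (fun x : A.Q => ∫ v, A.oracle k x v ∂P) =
        fun x : A.Q => A.meanOracle gradf gradg k x :=
      funext fun x => integral_oracle hPf hPg hGf hGg k x.2
    rwa [heq] at h
  exact (hm.comp measurable_fst).sub ho

variable [BorelSpace E] {Ω : Type*} {u : ℕ → Ω → Ξf × (∀ l, Ξg l)}

theorem measurable_iterate (hQ : IsCompact A.Q) (hne : A.Q.Nonempty)
    (hprox : IsProxFunction A.Q A.d A.gradD)
    (ho : ∀ k, Measurable fun p : A.Q × (Ξf × (∀ l, Ξg l)) => A.oracle k p.1 p.2) (k : ℕ) :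
    Measurable[pastSigma u k] fun ω => A.iterate (fun j => u j ω) k := by
  induction k with
  | zero => exact measurable_const
  | succ k ih =>
    have hx := ih.mono (pastSigma_mono u k.le_succ) le_rfl
    have hu := measurable_pastSigma u k.lt_succ_self
    have hmem := fun ω => iterate_mem hQ hne hprox (fun j => u j ω) k
    have h1 : Measurable[pastSigma u (k + 1)] fun ω =>
        A.oracle k (A.iterate (fun j => u j ω) k) (u k ω) :=
      (ho k).comp ((hx.subtype_mk (h := fun ω => (hmem ω).1)).prodMk hu)
    simp only [iterate_succ]
    exact hprox.measurable_mirrorStep hQ hx hmem (h1.const_smul A.η)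

theorem measurable_noiseIterate (hQ : IsCompact A.Q) (hne : A.Q.Nonempty)
    (hprox : IsProxFunction A.Q A.d A.gradD)
    (ho : ∀ k, Measurable fun p : A.Q × (Ξf × (∀ l, Ξg l)) => A.oracle k p.1 p.2)
    (hn : ∀ k, Measurable fun p : A.Q × (Ξf × (∀ l, Ξg l)) => A.noise gradf gradg k p.1 p.2)
    (k : ℕ) :
    Measurable[pastSigma u k] fun ω => A.noiseIterate gradf gradg (fun j => u j ω) k := by
  induction k with
  | zero => exact measurable_const
  | succ k ih =>
    have hy := ih.mono (pastSigma_mono u k.le_succ) le_rfl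
    have hx := (measurable_iterate hQ hne hprox ho k).mono (pastSigma_mono u k.le_succ) le_rfl
    have hu := measurable_pastSigma u k.lt_succ_self
    have hmem := fun ω => iterate_mem hQ hne hprox (fun j => u j ω) k
    have hmem' := fun ω => noiseIterate_mem (gradf := gradf) (gradg := gradg) hQ hne hprox
      (fun j => u j ω) k
    have h1 : Measurable[pastSigma u (k + 1)] fun ω =>
        A.noise gradf gradg k (A.iterate (fun j => u j ω) k) (u k ω) :=
      (hn k).comp ((hx.subtype_mk (h := fun ω => (hmem ω).1)).prodMk hu)
    exact hprox.measurable_mirrorStep hQ hy hmem' (h1.const_smul (A.η / 8))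

variable [MeasurableSpace Ω] {μ : Measure Ω} [IsProbabilityMeasure μ]

theorem ae_norm_oracle_iterate_le (hQ : IsCompact A.Q) (hne : A.Q.Nonempty)
    (hprox : IsProxFunction A.Q A.d A.gradD)
    (ho : ∀ k, Measurable fun p : A.Q × (Ξf × (∀ l, Ξg l)) => A.oracle k p.1 p.2)
    (hGf : IsStochasticSubgradient A.Q f gradf Pf A.Gf A.M)
    (hGg : ∀ l, IsStochasticSubgradient A.Q (g l) (gradg l) (Pg l) (A.Gg l) A.M)
    (hu_meas : ∀ k, Measurable (u k)) (hu_indep : iIndepFun u μ)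
    (hu_lawf : ∀ k, (μ.map (u k)).map (fun v => v.1) = Pf)
    (hu_lawg : ∀ k l, (μ.map (u k)).map (fun v => v.2 l) = Pg l) :
    ∀ᵐ ω ∂μ, ∀ k, ‖A.oracle k (A.iterate (fun j => u j ω) k) (u k ω)‖ ≤ A.M := by
  refine ae_all_iff.2 fun k => ?_
  set X : Ω → A.Q := fun ω => ⟨A.iterate (fun j => u j ω) k,
    (iterate_mem hQ hne hprox (fun j => u j ω) k).1⟩
  have hx : Measurable[pastSigma u k] X := (measurable_iterate hQ hne hprox ho k).subtype_mk
  have hp : MeasurableSet {q : A.Q × (Ξf × (∀ l, Ξg l)) | ‖A.oracle k q.1 q.2‖ ≤ A.M} :=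
    measurableSet_le (ho k).norm measurable_const
  have hb : ∀ x : A.Q, ∀ᵐ v ∂(μ.map (u k)), ‖A.oracle k x v‖ ≤ A.M := fun x =>
    ae_norm_oracle_le (hu_lawf k) (hu_lawg k) hGf hGg k x.2
  exact ae_of_measurable_pastSigma (p := fun q : A.Q × (Ξf × (∀ l, Ξg l)) =>
    ‖A.oracle k q.1 q.2‖ ≤ A.M) hu_meas hu_indep hx hp hb

/-- The correlation of the noise with the iterates is subgaussian. -/
theorem hasSubgaussianMGF_sum_noise (hM : 0 < A.M) (hQ : IsCompact A.Q) (hne : A.Q.Nonempty)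
    (hprox : IsProxFunction A.Q A.d A.gradD)
    (hgδ_meas : ∀ l, Measurable fun x : A.Q => A.gδ l x)
    (hpick_meas : ∀ k, Measurable fun x : A.Q => A.pick k x)
    (hGf : IsStochasticSubgradient A.Q f gradf Pf A.Gf A.M)
    (hGg : ∀ l, IsStochasticSubgradient A.Q (g l) (gradg l) (Pg l) (A.Gg l) A.M)
    (hu_meas : ∀ k, Measurable (u k)) (hu_indep : iIndepFun u μ)
    (hu_lawf : ∀ k, (μ.map (u k)).map (fun v => v.1) = Pf)
    (hu_lawg : ∀ k l, (μ.map (u k)).map (fun v => v.2 l) = Pg l)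
    {c : NNReal} (hc : 32 * A.thetaBarSq * A.M ^ 2 ≤ c ^ 2) (N : ℕ) :
    HasSubgaussianMGF (fun ω => ∑ k ∈ Finset.range N,
      A.noise gradf gradg k (A.iterate (fun j => u j ω) k) (u k ω)
        (A.iterate (fun j => u j ω) k - A.noiseIterate gradf gradg (fun j => u j ω) k))
      (N * c ^ 2) μ := by
  have hprob : ∀ k, IsProbabilityMeasure (μ.map (u k)) := fun k =>
    Measure.isProbabilityMeasure_map (hu_meas k).aemeasurable
  have ho := measurable_oracle hgδ_meas hpick_meas hGf hGg
  have hn : ∀ k, Measurable fun p : A.Q × (Ξf × (∀ l, Ξg l)) => A.noise gradf gradg k p.1 p.2 :=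
    fun k => measurable_noise (hu_lawf k) (hu_lawg k) hgδ_meas hpick_meas hGf hGg k
  have hx := measurable_iterate (u := u) hQ hne hprox ho
  have hy := measurable_noiseIterate (u := u) hQ hne hprox ho hn
  refine hasSubgaussianMGF_sum_range hu_meas hu_indep
    -- Values in `Q × Q` make the boundedness and mean-zero conditions available for every frozen
    -- `z`.
    (Z := fun k ω => ((⟨_, (iterate_mem hQ hne hprox (fun j => u j ω) k).1⟩ : A.Q),
      (⟨_, (noiseIterate_mem (gradf := gradf) (gradg := gradg) hQ hne hprox
        (fun j => u j ω) k).1⟩ : A.Q)))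
    (ψ := fun k p => A.noise gradf gradg k p.1.1 p.2 (p.1.1 - p.1.2))
    (fun k => (hx k).subtype_mk.prodMk (hy k).subtype_mk) (fun k => ?_) (fun k z => ?_)
    (fun k z => ?_) N
  · have h1 : Measurable fun p : (A.Q × A.Q) × (Ξf × (∀ l, Ξg l)) =>
        (A.noise gradf gradg k p.1.1 p.2, (p.1.1 : E) - p.1.2) :=
      ((hn k).comp ((measurable_fst.comp measurable_fst).prodMk measurable_snd)).prodMk
        (by fun_prop)
    exact isBoundedBilinearMap_apply.continuous.measurable.comp h1
  · filter_upwards [ae_norm_oracle_le (hu_lawf k) (hu_lawg k) hGf hGg k z.1.2] with v hv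
    have h1 := norm_meanOracle_le (hu_lawf k) (hu_lawg k) hGf hGg k z.1.2
    have h2 : ‖A.noise gradf gradg k z.1 v‖ ≤ 2 * A.M := (norm_sub_le _ _).trans (by linarith)
    have h3 := sq_norm_sub_le hQ hprox z.1.2 z.2.2
    refine ((A.noise gradf gradg k z.1 v).le_opNorm _).trans ?_
    refine abs_le_of_sq_le_sq' ?_ c.2 |>.2
    refine le_trans ?_ hc
    rw [mul_pow]
    calc _ ≤ (2 * A.M) ^ 2 * (8 * A.thetaBarSq) := by gcongr
      _ = _ := by ring
  · have hi : Integrable (fun v => A.oracle k z.1 v) (μ.map (u k)) :=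
      Integrable.of_bound ((ho k).comp measurable_prodMk_left).aestronglyMeasurable A.M
        (ae_norm_oracle_le (hu_lawf k) (hu_lawg k) hGf hGg k z.1.2)
    have hi' : Integrable (fun v => A.noise gradf gradg k z.1 v) (μ.map (u k)) :=
      (integrable_const _).sub hi
    dsimp only
    rw [← ContinuousLinearMap.integral_apply hi']
    unfold noise
    rw [integral_sub (integrable_const _) hi,
      integral_oracle (hu_lawf k) (hu_lawg k) hGf hGg k z.1.2]
    simp

end Stochastic

end MirrorDescent

/-! ### Choice of constants and conclusion. -/

theorem theorem2
    {E : Type*} [NormedAddCommGroup E] [NormedSpace ℝ E] [FiniteDimensional ℝ E]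
    [MeasurableSpace E] [BorelSpace E]
    {m : ℕ} {Ξf : Type*} [MeasurableSpace Ξf] {Ξg : Fin m → Type*} [∀ l, MeasurableSpace (Ξg l)]
    -- the method, with what it has access to
    (A : MirrorDescent E m Ξf Ξg)
    (hM : 0 < A.M) (hε : 0 < A.ε) (hδ : 0 ≤ A.δ)
    (hQ_convex : Convex ℝ A.Q) (hQ_compact : IsCompact A.Q)
    (hprox : IsProxFunction A.Q A.d A.gradD)
    -- the problem: minimize `f` over `Q` subject to `g l ≤ 0`
    (f : E → ℝ) (g : Fin m → E → ℝ)
    (hf_convex : ConvexOn ℝ A.Q f) (hg_convex : ∀ l, ConvexOn ℝ A.Q (g l))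
    (hf_lip : LipschitzOnWith A.M.toNNReal f A.Q)
    (hg_lip : ∀ l, LipschitzOnWith A.M.toNNReal (g l) A.Q)
    (hSlater : ∃ x ∈ A.Q, ∀ l, g l x < 0)
    -- the approximate constraints and the choice of a maximal one
    (hgδ : ∀ l, IsDeltaApprox A.Q A.δ (g l) (A.gδ l))
    (hgδ_meas : ∀ l, Measurable fun x : A.Q => A.gδ l x)
    (hpick : ∀ k, ∀ x ∈ A.Q, ∀ l, A.gδ l x ≤ A.gδ (A.pick k x) x)
    (hpick_meas : ∀ k, Measurable fun x : A.Q => A.pick k x)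
    -- the stochastic subgradient oracles
    (Pf : Measure Ξf) (Pg : ∀ l, Measure (Ξg l))
    (gradf : E → StrongDual ℝ E) (gradg : Fin m → E → StrongDual ℝ E)
    (hGf : IsStochasticSubgradient A.Q f gradf Pf A.Gf A.M)
    (hGg : ∀ l, IsStochasticSubgradient A.Q (g l) (gradg l) (Pg l) (A.Gg l) A.M)
    -- independent samples of the randomness of the oracles
    {Ω : Type*} [MeasurableSpace Ω] (μ : Measure Ω) [IsProbabilityMeasure μ]
    (u : ℕ → Ω → Ξf × (∀ l, Ξg l))
    (hu_meas : ∀ k, Measurable (u k))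
    (hu_indep : iIndepFun u μ)
    (hu_lawf : ∀ k, μ.map (fun ω => (u k ω).1) = Pf)
    (hu_lawg : ∀ k l, μ.map (fun ω => (u k ω).2 l) = Pg l)
    -- the confidence level and the number of steps
    (σ : ℝ) (hσ : σ ∈ Ioo (0 : ℝ) (1 / 2))
    (N : ℕ) (hN_pos : 1 ≤ N)
    (hN : 128 * A.thetaBarSq * A.M ^ 2 *
      (17 * Real.log (2 / σ) + 2 * nemirovskiConst (StrongDual ℝ E)) / A.ε ^ 2 ≤ (N : ℝ)) :
    1 - σ ≤ μ.real {ω |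
      (A.productiveSteps (fun k => u k ω) N).Nonempty ∧
      dualityGap A.Q f g (A.xHat (fun k => u k ω) N) (A.lamHat (fun k => u k ω) N) ≤ A.ε ∧
      ∀ l, g l (A.xHat (fun k => u k ω) N) ≤ A.ε + 2 * A.δ} := by
  have hne : A.Q.Nonempty := hSlater.imp fun _ h => h.1
  have hlawf : ∀ k, (μ.map (u k)).map (fun v => v.1) = Pf := fun k => by
    rw [Measure.map_map measurable_fst (hu_meas k)]; exact hu_lawf k
  have hlawg : ∀ k l, (μ.map (u k)).map (fun v => v.2 l) = Pg l := fun k l => by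
    rw [Measure.map_map (by fun_prop) (hu_meas k)]; exact hu_lawg k l
  have ho := MirrorDescent.measurable_oracle hgδ_meas hpick_meas hGf hGg
  have hNpos : (0 : ℝ) < N := by exact_mod_cast hN_pos
  have hκ : 0 ≤ nemirovskiConst (StrongDual ℝ E) := Real.sInf_nonneg fun _ h => h.1
  have hΘ : 0 ≤ A.thetaBarSq := MirrorDescent.thetaBarSq_nonneg hQ_compact hne hprox
  set L := Real.log (2 / σ) with hLdef
  have hL : 1 ≤ L := by
    rw [hLdef, Real.le_log_iff_exp_le (by have := hσ.1; positivity)]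
    refine (Real.exp_one_lt_three.le).trans ?_
    rw [le_div_iff₀ hσ.1]
    linarith [hσ.2]
  -- `2176 = 128 * 17`; the nonnegative `κ` term is dropped.
  have hΘM : 2176 * L * (A.thetaBarSq * A.M ^ 2) ≤ A.ε ^ 2 * N := by
    rw [div_le_iff₀ (by positivity)] at hN
    have : 0 ≤ A.thetaBarSq * A.M ^ 2 * nemirovskiConst (StrongDual ℝ E) := by positivity
    nlinarith
  -- This upper bound replaces `Θ̄₀² M²`, which is zero when `Q` is a point and then cannot be a
  -- divisor in the tail exponent.
  set B := A.ε ^ 2 * N / (2176 * L) with hB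
  have hBpos : 0 < B := by positivity
  have hΘB : A.thetaBarSq * A.M ^ 2 ≤ B := by
    rw [hB, le_div_iff₀ (by positivity)]; linarith
  set T : Ω → ℝ := fun ω => ∑ k ∈ Finset.range N,
      A.noise gradf gradg k (A.iterate (fun j => u j ω) k) (u k ω)
        (A.iterate (fun j => u j ω) k - A.noiseIterate gradf gradg (fun j => u j ω) k)
  have hc : 32 * A.thetaBarSq * A.M ^ 2 ≤ ((NNReal.sqrt (32 * B).toNNReal : NNReal) : ℝ) ^ 2 := by
    rw [← NNReal.coe_pow, NNReal.sq_sqrt, Real.coe_toNNReal _ (by positivity)]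
    linarith
  have hsub := MirrorDescent.hasSubgaussianMGF_sum_noise hM hQ_compact hne hprox hgδ_meas
    hpick_meas hGf hGg hu_meas hu_indep hlawf hlawg hc N
  -- The budget is `3/4 + 1/20 + 1/5 = 1` in units of `ε N`: stepsize terms, `Θ̄₀²` terms,
  -- martingale. With variance proxy `32 * B * N` the tail exponent is `34 L / 25 ≥ L`.
  have htail : μ.real {ω | A.ε * N / 5 ≤ T ω} ≤ σ := by
    refine (hsub.measure_ge_le (by positivity)).trans ?_
    have hexp : Real.exp (-L) = σ / 2 := by
      rw [hLdef, Real.exp_neg, Real.exp_log (by have := hσ.1; positivity), inv_div]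
    have h1 : Real.exp (-L) ≤ σ := by linarith [hσ.1]
    refine le_trans (Real.exp_le_exp.2 ?_) h1
    rw [NNReal.sq_sqrt, NNReal.coe_mul, Real.coe_toNNReal _ (by positivity), NNReal.coe_natCast,
      neg_div, neg_le_neg_iff, le_div_iff₀ (by positivity)]
    have h2 : B * (2176 * L) = A.ε ^ 2 * N := div_mul_cancel₀ _ (by positivity)
    have h3 : (A.ε * N / 5) ^ 2 = N * (B * (2176 * L)) / 25 := by rw [h2]; ring
    rw [h3]
    have : 0 ≤ N * B * L := by positivity
    linarith
  have hgood : 1 - σ ≤ μ.real {ω | A.ε * N / 5 ≤ T ω}ᶜ := by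
    have h1 := measureReal_union_le (μ := μ) {ω | A.ε * N / 5 ≤ T ω} {ω | A.ε * N / 5 ≤ T ω}ᶜ
    rw [union_compl_self, probReal_univ] at h1
    linarith
  refine hgood.trans (ENNReal.toReal_mono (measure_ne_top _ _) (measure_mono_ae ?_))
  filter_upwards [MirrorDescent.ae_norm_oracle_iterate_le hQ_compact hne hprox ho hGf hGg hu_meas
    hu_indep hlawf hlawg] with ω hω hT
  have hT' : T ω < A.ε * N / 5 := not_le.1 hT
  have : ∀ k, IsProbabilityMeasure (μ.map (u k)) := fun k =>
    Measure.isProbabilityMeasure_map (hu_meas k).aemeasurable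
  refine MirrorDescent.isPrimalDualSolution_of_sum_meanOracle_le (gradf := gradf) (gradg := gradg)
    f g hQ_compact hprox hf_convex hg_convex hSlater hgδ hpick hGf.isSubgradientOn
    (fun l => (hGg l).isSubgradientOn) hN_pos fun x hx => ?_
  refine (MirrorDescent.sum_meanOracle_le hM hε hQ_compact hprox
    (fun k x hx => MirrorDescent.norm_meanOracle_le (hlawf k) (hlawg k) hGf hGg k hx) hω hx
    N).trans ?_
  have h1 : 9 * A.thetaBarSq * A.M ^ 2 / A.ε ≤ A.ε * N / 20 := by
    rw [div_le_iff₀ hε]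
    have : 0 ≤ A.thetaBarSq * A.M ^ 2 := by positivity
    nlinarith [mul_le_mul_of_nonneg_right hL this]
  linarith
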